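/- An \emph{axis-aligned box} in $\mathbb{R}^3$ is a set $[a_1,b_1]\times[a_2,b_2]\times[a_3,b_3]$ with $a_i<b_i$ for $i=1,2,3$. It is a \emph{square box} if its top and bottom faces are squares, i.e. $b_1-a_1=b_2-a_2$. A square box $B$ is \emph{grounded} if $B$ meets the plane $\{x=y\}$ and $x\ge y$ for every point $(x,y,z)\in B$. The \emph{intersection graph} of a collection $\mathcal B$ of sets has vertex set $\mathcal B$, two distinct members being adjacent exactly when they have a point in common. The \emph{girth} of a graph is the length of its shortest cycle, and is $\infty$ if the graph has no cycle. \textbf{Theorem.} (i) For all integers $g\ge 3$ and $k\ge 1$ there is a finite collection of grounded square boxes in $\mathbb{R}^3$ whose intersection graph has girth at least $g$ and chromatic number at least $k$. (ii) Consequently, there are intersection graphs of axis-aligned boxes in $\mathbb{R}^3$ with arbitrarily large girth and chromatic number: for all integers $g,k\ge 0$ there is a finite collection of axis-aligned boxes in $\mathbb{R}^3$ whose intersection graph has girth at least $g$ and chromatic number at least $k$. -/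

import Mathlib

/-- Axis-aligned boxes in `ℝ³` (coordinates `0, 1, 2` are `x, y, z`): products
`[a₀, b₀] × [a₁, b₁] × [a₂, b₂]` of three closed bounded intervals of positive length. -/
def IsAxisBox (B : Set (Fin 3 → ℝ)) : Prop :=
  ∃ a b : Fin 3 → ℝ, (∀ i, a i < b i) ∧ B = Set.Icc a b

/-- Square boxes: axis-aligned boxes whose top and bottom faces (the faces orthogonal to the
`z`-axis) are squares. -/
def IsSquareBox (B : Set (Fin 3 → ℝ)) : Prop :=
  ∃ a b : Fin 3 → ℝ, (∀ i, a i < b i) ∧ B = Set.Icc a b ∧ b 0 - a 0 = b 1 - a 1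

/-- Grounded square boxes: square boxes that meet the plane `x = y` and lie in the half-space
`x ≥ y`. -/
def IsGroundedSquareBox (B : Set (Fin 3 → ℝ)) : Prop :=
  IsSquareBox B ∧ (B ∩ {p | p 0 = p 1}).Nonempty ∧ ∀ p ∈ B, p 1 ≤ p 0

/-- The intersection graph of a collection `𝓑` of sets: the vertices are the members of `𝓑`, and
two distinct members are adjacent exactly when they have a common point. -/
def intersectionGraph {α : Type*} (𝓑 : Set (Set α)) : SimpleGraph 𝓑 where
  Adj B C := B ≠ C ∧ ((B : Set α) ∩ (C : Set α)).Nonempty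
  symm := ⟨fun _ _ h => ⟨h.1.symm, by rw [Set.inter_comm]; exact h.2⟩⟩
  loopless := ⟨fun _ h => h.1 rfl⟩

/-! The proof is a Tutte-type induction on the number of colours. Given `G` that is not
`k`-colourable, take a hypergraph whose edges are indexed by the vertices of `G`, unavoidable for `k
+ 1` colours and without short Berge cycles, and match a fresh copy of `G` to each edge
(`substGraph`). The copy on a monochromatic edge must avoid the colour of that edge, so `k + 1`
colours do not suffice; sparseness preserves the girth. Boxes grounded at `(t, t)` and `(t', t')`
with sides `s, s'` and overlapping heights meet iff `|t - t'| ≤ min s s'`, a condition invariant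
under homothety. Hales-Jewett (`exists_unavoidable_homothetic`) supplies a hypergraph whose edges
are homothetic copies of the diagonal positions of `G`, and a partite construction
(`exists_sparse_lift`) makes it sparse over the same positions. Hypergraph vertices become tall thin
boxes (poles); the copies of `G` go into disjoint horizontal slabs (`IsBoxRep.exists_substGraph`).
-/

/-! ### Sparse unavoidable hypergraphs. -/

/-- The positions `i` of the edge `e` whose vertex lies on another edge of `T`. -/
def sharedIndices {V E ι : Type} (inc : E → ι → V) (T : Finset E) (e : E) : Set ι :=
  {i | ∃ e' ∈ T, e' ≠ e ∧ ∃ j, inc e' j = inc e i}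

/-- A hypergraph, given by its edges `inc e : ι → V`, such that every nonempty set of fewer than
`h` edges contains an edge sharing at most one vertex with the others, i.e. a hypergraph
without Berge cycles of length less than `h`. -/
def IsSparse {V E ι : Type} (inc : E → ι → V) (h : ℕ) : Prop :=
  ∀ T : Finset E, T.Nonempty → T.card < h → ∃ e ∈ T, (sharedIndices inc T e).Subsingleton

/-- Every colouring of the vertices by `C` has a monochromatic edge. -/
def IsUnavoidable {V E ι : Type} (inc : E → ι → V) (C : Type) : Prop :=
  ∀ c : V → C, ∃ e q, ∀ i, c (inc e i) = q

/-- A hyperforest has a leaf edge away from any prescribed root `x`: if a leaf `e` fails, delete it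
and take the vertex where `e` was attached as the new root. -/
theorem IsSparse.exists_subsingleton_union {V E ι : Type} {inc : E → ι → V} {h : ℕ}
    (H : IsSparse inc h) (hinj : ∀ e, Function.Injective (inc e)) (T : Finset E) (hT : T.Nonempty) (hc : T.card < h) (x : V) :
    ∃ e ∈ T, (sharedIndices inc T e ∪ {i | inc e i = x}).Subsingleton := by
  classical
  induction T using Finset.strongInduction generalizing x with
  | H T ih =>
    obtain ⟨e, heT, he⟩ := H T hT hc
    by_cases hsub : (sharedIndices inc T e ∪ {i | inc e i = x}).Subsingleton
    · exact ⟨e, heT, hsub⟩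
    by_cases hne : (sharedIndices inc T e).Nonempty
    · obtain ⟨i, hi⟩ := hne
      have hi' := hi
      by_cases hx : ∀ e' ∈ T, e' ≠ e → ∀ j, inc e' j ≠ x
      · obtain ⟨e₁, he₁, hne₁, -⟩ := hi
        have hlt := Finset.erase_ssubset heT
        obtain ⟨e', he', hs⟩ := ih (T.erase e) hlt ⟨e₁, Finset.mem_erase.2 ⟨hne₁, he₁⟩⟩
          ((Finset.card_lt_card hlt).trans hc) (inc e i)
        obtain ⟨hne', he'T⟩ := Finset.mem_erase.1 he'
        refine ⟨e', he'T, hs.anti ?_⟩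
        rintro j (⟨e₂, he₂, hne₂, k, hk⟩ | hj)
        · by_cases h2 : e₂ = e
          · subst h2
            right
            have : k ∈ sharedIndices inc T e₂ := ⟨e', he'T, hne', j, hk.symm⟩
            rw [Set.mem_ofPred_eq, ← hk, he this hi']
          · exact Or.inl ⟨e₂, Finset.mem_erase.2 ⟨h2, he₂⟩, hne₂, k, hk⟩
        · exact absurd hj (hx e' he'T hne' j)
      · push Not at hx
        obtain ⟨e', he', hne', j, hj⟩ := hx
        refine absurd (he.anti ?_) hsub
        rintro k (hk | hk)
        · exact hk
        · exact ⟨e', he', hne', j, hj.trans hk.symm⟩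
    · refine ⟨e, heT, ?_⟩
      rw [Set.not_nonempty_iff_eq_empty.1 hne, Set.empty_union]
      exact fun i hi j hj => hinj e (hi.trans hj.symm)

theorem IsSparse.exists_subsingleton_union_preimage {V E ι : Type} {inc : E → ι → V} {h : ℕ}
    (H : IsSparse inc h) (hinj : ∀ e, Function.Injective (inc e)) (T : Finset E)
    (hT : T.Nonempty) (hc : T.card < h) {X : Set V} (hX : X.Subsingleton) :
    ∃ e ∈ T, (sharedIndices inc T e ∪ inc e ⁻¹' X).Subsingleton := by
  rcases hX.eq_empty_or_singleton with rfl | ⟨x, rfl⟩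
  · simpa using H T hT hc
  · exact H.exists_subsingleton_union hinj T hT hc x

theorem exists_uniform_unavoidable (ι C : Type) [Finite ι] [Finite C] [Nonempty C] :
    ∃ (V E : Type) (_ : Finite V) (_ : Finite E) (inc : E → ι → V),
      (∀ e, Function.Injective (inc e)) ∧ IsUnavoidable inc C := by
  classical
  have := Fintype.ofFinite ι
  have := Fintype.ofFinite C
  refine ⟨Fin (Fintype.card C * Fintype.card ι), ι ↪ Fin (Fintype.card C * Fintype.card ι),
    inferInstance, inferInstance, fun e => e, fun e => e.injective, fun c => ?_⟩
  -- Pigeonhole: some colour class has at least `|ι|` points.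
  obtain ⟨q, hq⟩ := Fintype.exists_le_card_fiber_of_mul_le_card c
    (n := Fintype.card ι) (by simp)
  rw [← Fintype.card_subtype] at hq
  obtain ⟨f⟩ := Function.Embedding.nonempty_of_card_le hq
  exact ⟨f.trans (Function.Embedding.subtype _), q, fun i => (f i).2⟩

/-- The amalgamation of copies of the hypergraph `inc`, one for each edge of the hypergraph
`incW`, identifying the fibre of `π` over `a` in each copy with the corresponding edge. -/
def amalgam {V V' E' W F ι : Type} [DecidableEq V] (inc : E' → ι → V') (π : V' → V) (a : V)
    (incW : F → {v // π v = a} → W) : F × E' → ι → W ⊕ (F × V') :=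
  fun p i => if h : π (inc p.2 i) = a then Sum.inl (incW p.1 ⟨_, h⟩)
    else Sum.inr (p.1, inc p.2 i)

theorem IsSparse.amalgam {V V' E' W F ι : Type} [DecidableEq V] {inc : E' → ι → V'}
    {π : V' → V} {a : V} {incW : F → {v // π v = a} → W} {h : ℕ}
    (hπ : ∀ e, Function.Injective fun i => π (inc e i))
    (hW' : ∀ f, Function.Injective (incW f)) (hW : IsSparse incW h) (hP : IsSparse inc (h + 1)) :
    IsSparse (amalgam inc π a incW) (h + 1) := by
  classical
  intro T hT hc
  have hinj : ∀ e, Function.Injective (inc e) := fun e i j hij => hπ e (congrArg π hij)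
  -- vertices shared by edges of different copies lie in the fibre over `a`
  have key : ∀ f e i f' e' j, f' ≠ f →
      _root_.amalgam inc π a incW (f', e') j = _root_.amalgam inc π a incW (f, e) i →
      ∃ (h : π (inc e i) = a) (h' : π (inc e' j) = a), incW f' ⟨_, h'⟩ = incW f ⟨_, h⟩ := by
    intro f e i f' e' j hne heq
    unfold _root_.amalgam at heq
    split_ifs at heq with h1 h2 h2
    · exact ⟨h2, h1, Sum.inl_injective heq⟩
    · exact absurd (congrArg Prod.fst (Sum.inr_injective heq)) hne
  let T₁ := T.image Prod.fst
  rcases lt_or_ge T₁.card h with hlt | hge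
  -- Copy `f` is glued to the other copies in at most one vertex; that vertex is the root for
  -- choosing a leaf edge inside the copy.
  · obtain ⟨f, hf, hs⟩ := hW T₁ (hT.image _) hlt
    let T₂ := (T.filter (·.1 = f)).image Prod.snd
    have hT₂ : T₂.Nonempty := by
      obtain ⟨p, hp, hpf⟩ := Finset.mem_image.1 hf
      exact ⟨p.2, Finset.mem_image.2 ⟨p, Finset.mem_filter.2 ⟨hp, hpf⟩, rfl⟩⟩
    have hc₂ : T₂.card < h + 1 :=
      ((Finset.card_image_le).trans (Finset.card_filter_le _ _)).trans_lt hc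
    have memT₂ : ∀ e, (f, e) ∈ T → e ∈ T₂ := fun e he =>
      Finset.mem_image.2 ⟨(f, e), Finset.mem_filter.2 ⟨he, rfl⟩, rfl⟩
    obtain ⟨e, he, hse⟩ := hP.exists_subsingleton_union_preimage hinj T₂ hT₂ hc₂
      (hs.image Subtype.val)
    obtain ⟨p, hp, rfl⟩ := Finset.mem_image.1 he
    obtain ⟨hpT, rfl⟩ := Finset.mem_filter.1 hp
    refine ⟨p, hpT, hse.anti ?_⟩
    rintro i ⟨⟨f', e'⟩, hp', hne, j, heq⟩
    by_cases hf' : f' = p.1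
    · subst hf'
      refine Or.inl ⟨e', memT₂ e' hp', fun h => hne (by rw [h]), j, ?_⟩
      unfold _root_.amalgam at heq
      split_ifs at heq with h1 h2 h2
      · exact congrArg Subtype.val (hW' _ (Sum.inl_injective heq))
      · exact congrArg Prod.snd (Sum.inr_injective heq)
    · obtain ⟨h1, h2, h3⟩ := key p.1 p.2 i f' e' j hf' heq
      exact Or.inr ⟨⟨_, h1⟩, ⟨f', Finset.mem_image_of_mem _ hp', hf', _, h3⟩, rfl⟩
  -- Here the edges lie in distinct copies, so they share vertices only over `a`, and each edge
  -- meets that fibre at most once.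
  · have hinjOn : Set.InjOn Prod.fst (T : Set (F × E')) :=
      Finset.card_image_iff.1 (le_antisymm Finset.card_image_le 
        ((Nat.lt_succ_iff.1 hc).trans hge))
    obtain ⟨⟨f, e⟩, hp⟩ := hT
    refine ⟨(f, e), hp, ?_⟩
    have hfib : ∀ i ∈ sharedIndices (_root_.amalgam inc π a incW) T (f, e),
        π (inc e i) = a := by
      rintro i ⟨⟨f', e'⟩, hp', hne, j, heq⟩
      exact (key f e i f' e' j (fun h => hne (hinjOn hp' hp h)) heq).1
    exact fun i hi j hj => hπ e ((hfib i hi).trans (hfib j hj).symm)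

theorem exists_sparse_lift (C : Type) [Finite C] [Nonempty C] (h : ℕ) :
    ∀ {V E ι : Type} [Finite V] [Finite E] [Finite ι] (inc : E → ι → V),
      (∀ e, Function.Injective (inc e)) → IsUnavoidable inc C →
      ∃ (V' E' : Type) (_ : Finite V') (_ : Finite E') (inc' : E' → ι → V') (π : V' → V)
        (ρ : E' → E), (∀ e i, π (inc' e i) = inc (ρ e) i) ∧ IsUnavoidable inc' C ∧
          IsSparse inc' h := by
  classical
  induction h with
  | zero =>
    intro V E ι _ _ _ inc _ hun
    exact ⟨V, E, inferInstance, inferInstance, inc, id, id, fun _ _ => rfl, hun,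
      fun T _ hc => absurd hc (Nat.not_lt_zero _)⟩
  | succ h ih =>
    intro V E ι _ _ _ inc hinj hun
    have := Fintype.ofFinite V
    -- a section of the lift on which the colour depends only on the vertex below, for
    -- vertices in a given set `A`
    have main : ∀ A : Finset V, ∃ (V' E' : Type) (_ : Finite V') (_ : Finite E')
        (inc' : E' → ι → V') (π : V' → V) (ρ : E' → E),
        (∀ e i, π (inc' e i) = inc (ρ e) i) ∧ IsSparse inc' (h + 1) ∧
        ∀ c : V' → C, ∃ (s : E → E') (q : V → C), (∀ e, ρ (s e) = e) ∧
          ∀ e i, inc e i ∈ A → c (inc' (s e) i) = q (inc e i) := by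
      intro A
      induction A using Finset.induction_on with
      | empty =>
        refine ⟨E × ι, E, inferInstance, inferInstance, fun e i => (e, i),
          fun p => inc p.1 p.2, id, fun _ _ => rfl, ?_, ?_⟩
        · rintro T ⟨e, he⟩ -
          refine ⟨e, he, ?_⟩
          rintro i ⟨e', -, hne, j, hj⟩
          exact absurd (congrArg Prod.fst hj) hne
        · intro c
          exact ⟨id, fun _ => Classical.arbitrary C, fun _ => rfl, by simp⟩
      | insert a A ha ihA =>
        obtain ⟨V', E', _, _, inc', π, ρ, hπ, hsp, hcol⟩ := ihA
        obtain ⟨W₀, F₀, _, _, incW₀, hW₀, hun₀⟩ :=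
          exists_uniform_unavoidable {v // π v = a} C
        -- Sparseness `h` suffices for the gluing hypergraph; amalgamation keeps `h + 1`.
        obtain ⟨W, F, _, _, incW, π₁, ρ₁, hπ₁, hunW, hspW⟩ := ih incW₀ hW₀ hun₀
        have hW : ∀ f, Function.Injective (incW f) := fun f u v huv =>
          hW₀ (ρ₁ f) (by rw [← hπ₁, ← hπ₁, huv])
        refine ⟨W ⊕ (F × V'), F × E', inferInstance, inferInstance,
          amalgam inc' π a incW, Sum.elim (fun _ => a) (fun p => π p.2), fun p => ρ p.2,
          ?_, ?_, ?_⟩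
        · intro p i
          unfold amalgam
          split_ifs with h1
          · rw [Sum.elim_inl, ← hπ, h1]
          · rw [Sum.elim_inr, hπ]
        · refine IsSparse.amalgam (fun e i j hij => hinj (ρ e) ?_) hW hspW hsp
          simpa only [hπ] using hij
        · intro c
          -- In copy `f` the whole fibre over `a` has colour `q₀`; the vertices of `A` are handled
          -- inside this copy.
          obtain ⟨f, q₀, hf⟩ := hunW (fun w => c (Sum.inl w))
          obtain ⟨s, q, hs, hq⟩ := hcol (fun v => if h : π v = a then
            c (Sum.inl (incW f ⟨v, h⟩)) else c (Sum.inr (f, v)))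
          refine ⟨fun e => (f, s e), Function.update q a q₀, hs, fun e i hi => ?_⟩
          have hπe : π (inc' (s e) i) = inc e i := by rw [hπ, hs]
          by_cases h1 : inc e i = a
          · have h2 := hπe.trans h1
            simp only [amalgam, h2, dif_pos, h1, Function.update_self]
            exact hf _
          · have h2 : π (inc' (s e) i) ≠ a := by rwa [hπe]
            have h3 := hq e i ((Finset.mem_insert.1 hi).resolve_left h1)
            simp only [amalgam, dif_neg h2, Function.update_of_ne h1] at h3 ⊢
            exact h3
    obtain ⟨V', E', i₁, i₂, inc', π, ρ, hπ, hsp, hcol⟩ := main Finset.univ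
    refine ⟨V', E', i₁, i₂, inc', π, ρ, hπ, fun c => ?_, hsp⟩
    obtain ⟨s, q, -, hq⟩ := hcol c
    obtain ⟨e, q₀, he⟩ := hun q
    exact ⟨s e, q₀, fun i => (hq e i (Finset.mem_univ _)).trans (he i)⟩

/-! ### Girth and chromatic number under substitution. -/

/-- Every nonempty set of fewer than `g` vertices contains a vertex with at most one neighbour
in the set. -/
def IsLocallyAcyclic {V : Type} (G : SimpleGraph V) (g : ℕ) : Prop :=
  ∀ S : Finset V, S.Nonempty → S.card < g → ∃ v ∈ S, {w | w ∈ S ∧ G.Adj v w}.Subsingleton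

/-- A forest on at least two vertices has two leaves: delete the leaf `u` and find a leaf of the
rest other than the neighbour of `u`. -/
theorem IsLocallyAcyclic.exists_ne {V : Type} {G : SimpleGraph V} {g : ℕ}
    (H : IsLocallyAcyclic G g) (S : Finset V) (hS : S.Nontrivial) (hc : S.card < g) (u : V) :
    ∃ v ∈ S, v ≠ u ∧ {w | w ∈ S ∧ G.Adj v w}.Subsingleton := by
  classical
  induction S using Finset.strongInduction generalizing u with
  | H S ih =>
    obtain ⟨v, hv, hs⟩ := H S hS.nonempty hc
    by_cases hvu : v = u
    · subst hvu
      have hlt := Finset.erase_ssubset hv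
      have hne : (S.erase v).Nonempty := hS.erase_nonempty
      -- the only possible neighbour of `v`
      obtain ⟨x, hx⟩ : ∃ x, ∀ w ∈ S, G.Adj v w → w = x := by
        by_cases hn : ∃ x ∈ S, G.Adj v x
        · obtain ⟨x, hxS, hx⟩ := hn
          exact ⟨x, fun w hw hvw => hs ⟨hw, hvw⟩ ⟨hxS, hx⟩⟩
        · exact ⟨v, fun w hw hvw => absurd ⟨w, hw, hvw⟩ hn⟩
      by_cases hnt : (S.erase v).Nontrivial
      · obtain ⟨y, hy, hyx, hys⟩ := ih _ hlt hnt ((Finset.card_lt_card hlt).trans hc) x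
        obtain ⟨hyv, hyS⟩ := Finset.mem_erase.1 hy
        refine ⟨y, hyS, hyv, hys.anti ?_⟩
        rintro w ⟨hwS, hyw⟩
        refine ⟨Finset.mem_erase.2 ⟨?_, hwS⟩, hyw⟩
        rintro rfl
        exact hyx (hx y hyS hyw.symm)
      · obtain ⟨y, hy⟩ := hne
        obtain ⟨hyv, hyS⟩ := Finset.mem_erase.1 hy
        have huniq : ∀ w ∈ S, w ≠ v → w = y := by
          intro w hw hwv
          by_contra hwy
          exact hnt ⟨w, Finset.mem_coe.2 (Finset.mem_erase.2 ⟨hwv, hw⟩), y,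
            Finset.mem_coe.2 hy, hwy⟩
        have hv' : ∀ w ∈ S, G.Adj y w → w = v := fun w hw hyw => by
          by_contra hwv
          exact hyw.ne (huniq w hw hwv).symm
        exact ⟨y, hyS, hyv, fun a ha b hb => (hv' a ha.1 ha.2).trans (hv' b hb.1 hb.2).symm⟩
    · exact ⟨v, hv, hvu, hs⟩

theorem IsLocallyAcyclic.le_egirth {V : Type} {G : SimpleGraph V} {g : ℕ}
    (H : IsLocallyAcyclic G g) : (g : ℕ∞) ≤ G.egirth := by
  classical
  rw [SimpleGraph.le_egirth]
  intro a w hw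
  by_contra hlt
  rw [not_le, Nat.cast_lt] at hlt
  have hmem : ∀ x, x ∈ w.support ↔ x ∈ w.support.tail := by
    intro x
    refine ⟨fun hx => ?_, List.mem_of_mem_tail⟩
    rcases (SimpleGraph.Walk.mem_support_iff _).1 hx with rfl | h
    · exact SimpleGraph.Walk.end_mem_tail_support hw.not_nil
    · exact h
  -- The tail drops the repeated base point, so its length is that of the cycle.
  obtain ⟨v, hv, hs⟩ := H w.support.tail.toFinset
    ⟨a, List.mem_toFinset.2 ((hmem a).1 w.start_mem_support)⟩
    ((List.toFinset_card_le _).trans_lt (by simpa using hlt))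
  have h2 := hw.ncard_neighborSet_toSubgraph_eq_two ((hmem v).2 (List.mem_toFinset.1 hv))
  have hss : (w.toSubgraph.neighborSet v).Subsingleton := by
    refine hs.anti fun x hx => ⟨?_, w.toSubgraph.adj_sub hx⟩
    rw [List.mem_toFinset, ← hmem, ← SimpleGraph.Walk.mem_verts_toSubgraph]
    exact w.toSubgraph.edge_vert hx.symm
  obtain ⟨x, y, hxy, h⟩ := Set.ncard_eq_two.1 h2
  exact hxy (hss (h ▸ Set.mem_insert x _) (h ▸ Set.mem_insert_of_mem x rfl))

/-- The graph on the vertices of the hypergraph `inc` and a copy of `G` for each of its edges, in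
which the vertices of each copy are matched with those of the edge. -/
def substGraph {Y E V : Type} (inc : E → V → Y) (G : SimpleGraph V) :
    SimpleGraph (Y ⊕ (E × V)) where
  Adj
    | .inl _, .inl _ => False
    | .inl y, .inr p => inc p.1 p.2 = y
    | .inr p, .inl y => inc p.1 p.2 = y
    | .inr p, .inr p' => p.1 = p'.1 ∧ G.Adj p.2 p'.2
  symm := ⟨by
    rintro (y | p) (y' | p') h
    · exact h
    · exact h
    · exact h
    · exact ⟨h.1.symm, h.2.symm⟩⟩
  loopless := ⟨by
    rintro (y | p) h
    · exact h
    · exact G.irrefl h.2⟩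

theorem IsLocallyAcyclic.substGraph {Y E V : Type} {inc : E → V → Y} {G : SimpleGraph V} {g : ℕ}
    (hinj : ∀ e, Function.Injective (inc e)) (hsp : IsSparse inc g) (hG : IsLocallyAcyclic G g) :
    IsLocallyAcyclic (substGraph inc G) g := by
  classical
  intro S hS hc
  let P := S.toRight
  have hP : ∀ p, p ∈ P ↔ Sum.inr p ∈ S := fun p => Finset.mem_toRight
  have hPc : P.card ≤ S.card := Finset.card_toRight_le
  let T := P.image Prod.fst
  rcases P.eq_empty_or_nonempty with hP0 | hPn
  · obtain ⟨x, hx⟩ := hS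
    refine ⟨x, hx, ?_⟩
    rcases x with y | p
    · rintro (z | q) ⟨hz, hyz⟩
      · exact hyz.elim
      · exact absurd ((hP q).2 hz) (by simp [hP0])
    · exact absurd ((hP p).2 hx) (by simp [hP0])
  obtain ⟨e, he, hs⟩ := hsp T (hPn.image _) ((Finset.card_image_le.trans hPc).trans_lt hc)
  let Q := (P.filter (·.1 = e)).image Prod.snd
  have hQ : ∀ v, v ∈ Q ↔ Sum.inr (e, v) ∈ S := by
    intro v
    rw [← hP]
    constructor
    · intro hv
      obtain ⟨p, hp, rfl⟩ := Finset.mem_image.1 hv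
      obtain ⟨hpP, rfl⟩ := Finset.mem_filter.1 hp
      exact hpP
    · exact fun hv => Finset.mem_image.2 ⟨(e, v), Finset.mem_filter.2 ⟨hv, rfl⟩, rfl⟩
  have hQc : Q.card < g :=
    ((Finset.card_image_le.trans (Finset.card_filter_le _ _)).trans hPc).trans_lt hc
  have hQn : Q.Nonempty := by
    obtain ⟨p, hp, rfl⟩ := Finset.mem_image.1 he
    exact ⟨p.2, (hQ _).2 ((hP _).1 hp)⟩
  by_cases hnt : Q.Nontrivial
  · -- a leaf of the copy of `G` at `e` whose partner is not on another copy
    obtain ⟨v, hvQ, hvs, hvl⟩ : ∃ v ∈ Q, v ∉ sharedIndices inc T e ∧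
        {w | w ∈ Q ∧ G.Adj v w}.Subsingleton := by
      by_cases hsh : (sharedIndices inc T e).Nonempty
      · obtain ⟨u, hu⟩ := hsh
        obtain ⟨v, hv, hvu, hvl⟩ := hG.exists_ne Q hnt hQc u
        exact ⟨v, hv, fun h => hvu (hs h hu), hvl⟩
      · obtain ⟨v, hv, hvl⟩ := hG Q hQn hQc
        exact ⟨v, hv, fun h => hsh ⟨v, h⟩, hvl⟩
    -- If the pole of `v` is in `S`, its only neighbour there is `v`; otherwise `v` itself is a
    -- leaf.
    by_cases hy : Sum.inl (inc e v) ∈ S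
    · refine ⟨_, hy, ?_⟩
      have : ∀ x, x ∈ S ∧ (_root_.substGraph inc G).Adj (Sum.inl (inc e v)) x →
          x = Sum.inr (e, v) := by
        rintro (z | ⟨e', v'⟩) ⟨hz, hyz⟩
        · exact hyz.elim
        · change inc e' v' = inc e v at hyz
          by_cases hee : e' = e
          · subst hee
            rw [hinj _ hyz]
          · exact absurd ⟨e', Finset.mem_image.2 ⟨_, (hP _).2 hz, rfl⟩, hee, v', hyz⟩ hvs
      exact fun a ha b hb => (this a ha).trans (this b hb).symm
    · refine ⟨_, (hQ v).1 hvQ, ?_⟩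
      have : ∀ x, x ∈ S ∧ (_root_.substGraph inc G).Adj (Sum.inr (e, v)) x →
          ∃ w, x = Sum.inr (e, w) ∧ w ∈ Q ∧ G.Adj v w := by
        rintro (z | ⟨e', v'⟩) ⟨hz, hyz⟩
        · change inc e v = z at hyz
          exact absurd (hyz ▸ hz) hy
        · obtain ⟨h1, h2⟩ := hyz
          change e = e' at h1
          subst h1
          exact ⟨v', rfl, (hQ _).2 hz, h2⟩
      intro a ha b hb
      obtain ⟨w, rfl, hw⟩ := this a ha
      obtain ⟨w', rfl, hw'⟩ := this b hb
      rw [hvl hw hw']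
  · obtain ⟨v, hv⟩ := hQn
    refine ⟨_, (hQ v).1 hv, ?_⟩
    have : ∀ x, x ∈ S ∧ (_root_.substGraph inc G).Adj (Sum.inr (e, v)) x →
        x = Sum.inl (inc e v) := by
      rintro (z | ⟨e', v'⟩) ⟨hz, hyz⟩
      · exact congrArg _ (Eq.symm hyz)
      · obtain ⟨h1, h2⟩ := hyz
        change e = e' at h1
        subst h1
        exact absurd ⟨v, Finset.mem_coe.2 hv, v', Finset.mem_coe.2 ((hQ _).2 hz), h2.ne⟩ hnt
    exact fun a ha b hb => (this a ha).trans (this b hb).symm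

theorem not_colorable_substGraph {Y E V : Type} {inc : E → V → Y} {G : SimpleGraph V} {k : ℕ}
    (hun : IsUnavoidable inc (Fin (k + 1))) (hG : ¬ G.Colorable k) :
    ¬ (substGraph inc G).Colorable (k + 1) := by
  rintro ⟨c⟩
  obtain ⟨e, q, hq⟩ := hun (fun y => c (Sum.inl y))
  refine hG ?_
  have hne : ∀ v, c (Sum.inr (e, v)) ≠ q := fun v h =>
    c.valid (show (substGraph inc G).Adj (Sum.inr (e, v)) (Sum.inl (inc e v)) from rfl)
      (h.trans (hq v).symm)
  let c' : G.Coloring {x : Fin (k + 1) // x ≠ q} :=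
    SimpleGraph.Coloring.mk (fun v => ⟨c (Sum.inr (e, v)), hne v⟩) fun {u v} huv h =>
      c.valid (show (substGraph inc G).Adj (Sum.inr (e, u)) (Sum.inr (e, v)) from ⟨rfl, huv⟩)
        (congrArg Subtype.val h)
  simpa using c'.colorable

/-! ### Box representations and their substitution. -/

/-- A representation of `G` by grounded square boxes
`[t v, t v + s v] × [t v - s v, t v] × [lo v, hi v]`, any two of which either are disjoint or
intersect robustly under small changes of `t`, together with distinctness of the boxes. -/
structure IsBoxRep {V : Type} (G : SimpleGraph V) (t s lo hi : V → ℝ) : Prop where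
  s_pos : ∀ v, 0 < s v
  lo_lt_hi : ∀ v, lo v < hi v
  adj_iff : ∀ u v, u ≠ v →
    (G.Adj u v ↔ (lo u ≤ hi v ∧ lo v ≤ hi u) ∧ |t u - t v| < min (s u) (s v))
  generic : ∀ u v, u ≠ v → lo u ≤ hi v ∧ lo v ≤ hi u → |t u - t v| ≠ min (s u) (s v)
  ext : ∀ u v, t u = t v → lo u = lo v → u = v

theorem exists_injective_near {Y : Type} [Finite Y] (q : Y → ℝ) {ε : ℝ} (hε : 0 < ε) :
    ∃ p : Y → ℝ, Function.Injective p ∧ ∀ y, |p y - q y| < ε := by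
  classical
  have := Fintype.ofFinite Y
  have h : ∀ A : Finset Y, ∃ p : Y → ℝ, Set.InjOn p A ∧ ∀ y, |p y - q y| < ε := by
    intro A
    induction A using Finset.induction_on with
    | empty => exact ⟨q, by simp, fun _ => by simpa using hε⟩
    | insert a A ha ih =>
      obtain ⟨p, hp, hq⟩ := ih
      obtain ⟨x, hx, hxA⟩ := ((Set.Ioo_infinite (show q a < q a + ε by linarith)).sdiff
        (A.image p).finite_toSet).nonempty
      refine ⟨Function.update p a x, ?_, fun y => ?_⟩
      · rw [Finset.coe_insert, Set.injOn_insert (by simpa using ha)]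
        have heq : Set.EqOn (Function.update p a x) p A := fun y hy =>
          Function.update_of_ne (fun h => ha (by rw [← h]; exact hy)) _ _
        refine ⟨heq.injOn_iff.2 hp, ?_⟩
        rw [heq.image_eq, Function.update_self]
        simpa using hxA
      · by_cases hy : y = a
        · subst hy
          rw [Function.update_self, abs_lt]
          constructor <;> linarith [hx.1, hx.2]
        · rw [Function.update_of_ne hy]
          exact hq y
  obtain ⟨p, hp, hq⟩ := h Finset.univ
  exact ⟨p, by simpa [Set.injOn_univ] using hp, hq⟩

theorem exists_pos_lt_of_finite {A : Type} [Finite A] (f : A → ℝ) (hf : ∀ a, 0 < f a) :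
    ∃ ε > 0, ∀ a, ε < f a := by
  rcases isEmpty_or_nonempty A with h | h
  · exact ⟨1, one_pos, fun a => h.elim a⟩
  · obtain ⟨a, ha⟩ := Finite.exists_min f
    exact ⟨f a / 2, half_pos (hf a), fun b => by linarith [ha b, hf a]⟩

/-- The Hales-Jewett hypergraph, mapped to the real line. -/
theorem exists_unavoidable_homothetic (V C : Type) [Finite V] [Finite C] (t : V → ℝ) :
    ∃ (Y E : Type) (_ : Finite Y) (_ : Finite E) (inc : E → V → Y) (q : Y → ℝ) (m : E → ℝ)
      (b : E → ℝ), (∀ e, Function.Injective (inc e)) ∧ IsUnavoidable inc C ∧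
        (∀ e, 1 ≤ m e) ∧ ∀ e v, q (inc e v) = m e * t v + b e := by
  classical
  obtain ⟨ι, _, hι⟩ := Combinatorics.Line.exists_mono_in_high_dimension V C
  have hfin : Finite (Combinatorics.Line V ι) := Finite.of_injective
    (fun l => l.idxFun) fun l l' h => by cases l; cases l'; congr
  -- Summing `t` over the coordinates of a line gives slope `m`, the number of active coordinates,
  -- and intercept the sum over the fixed ones; active ones contribute the default `0`.
  let m : Combinatorics.Line V ι → ℕ := fun l => (Finset.univ.filter (l.idxFun · = none)).card
  refine ⟨ι → V, Combinatorics.Line V ι, inferInstance, hfin, fun l => l,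
    fun x => ∑ i, t (x i), fun l => m l, fun l => ∑ i, ((l.idxFun i).map t).getD 0,
    fun l u v huv => ?_, fun c => ?_, fun l => ?_, fun l v => ?_⟩
  · obtain ⟨i, hi⟩ := l.proper
    simpa [hi] using congrFun huv i
  · obtain ⟨l, q, h⟩ := hι c
    exact ⟨l, q, h⟩
  · obtain ⟨i, hi⟩ := l.proper
    have hpos : 0 < m l := Finset.card_pos.2 ⟨i, by simpa using hi⟩
    change (1 : ℝ) ≤ (m l : ℕ)
    exact_mod_cast hpos
  · have h1 : (m l : ℝ) * t v = ∑ i, if l.idxFun i = none then t v else 0 := by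
      simp [m, ← Finset.sum_filter]
    rw [h1, ← Finset.sum_add_distrib]
    refine Finset.sum_congr rfl fun i _ => ?_
    cases h : l.idxFun i <;> simp [h]

theorem IsBoxRep.exists_margin {V : Type} [Finite V] {G : SimpleGraph V} {t s lo hi : V → ℝ}
    (H : IsBoxRep G t s lo hi) : ∃ ε > 0, ∀ u v, u ≠ v → lo u ≤ hi v ∧ lo v ≤ hi u →
      ε < |(|t u - t v| - min (s u) (s v))| := by
  obtain ⟨ε, hε, h⟩ := exists_pos_lt_of_finite
    (A := {p : V × V // p.1 ≠ p.2 ∧ lo p.1 ≤ hi p.2 ∧ lo p.2 ≤ hi p.1})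
    (fun p => |(|t p.1.1 - t p.1.2| - min (s p.1.1) (s p.1.2))|)
    (fun p => abs_pos.2 (sub_ne_zero.2 (H.generic _ _ p.2.1 p.2.2)))
  exact ⟨ε, hε, fun u v huv hz => h ⟨(u, v), huv, hz⟩⟩

/-- Scaling by `m ≥ 1` does not shrink the margin, so an error below `ε` cannot cross the threshold.
-/
theorem abs_lt_iff_of_margin {ε m d r x : ℝ} (hm : 1 ≤ m) (h : ε < |(|d| - r)|)
    (hx : |x - m * d| < ε) : (|x| < m * r ↔ |d| < r) ∧ |x| ≠ m * r := by
  have hmd : |m * d| = m * |d| := by rw [abs_mul, abs_of_pos (by linarith)]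
  have h1 : |(|x| - m * |d|)| < ε := hmd ▸ (abs_abs_sub_abs_le x (m * d)).trans_lt hx
  have hε : 0 < ε := (abs_nonneg _).trans_lt hx
  obtain ⟨h2, h3⟩ := abs_lt.1 h1
  rcases lt_abs.1 h with h4 | h4
  · have h5 : ε ≤ m * (|d| - r) := by nlinarith
    refine ⟨⟨fun h => ?_, fun h => ?_⟩, fun h => ?_⟩ <;> linarith
  · have h5 : ε ≤ m * (r - |d|) := by nlinarith
    refine ⟨⟨fun h => ?_, fun h => ?_⟩, fun h => ?_⟩ <;> linarith

theorem IsBoxRep.exists_substGraph {V : Type} [Finite V] {G : SimpleGraph V}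
    {t s lo hi : V → ℝ} (H : IsBoxRep G t s lo hi) {Y E : Type} [Finite Y] [Finite E]
    {inc : E → V → Y} (hinj : ∀ e, Function.Injective (inc e)) (q : Y → ℝ) (m b : E → ℝ)
    (hm : ∀ e, 1 ≤ m e) (hq : ∀ e v, q (inc e v) = m e * t v + b e) :
    ∃ t' s' lo' hi', IsBoxRep (substGraph inc G) t' s' lo' hi' := by
  classical
  obtain ⟨ε, hε, hmargin⟩ := H.exists_margin
  -- Distinct poles may have equal `q`. Moving each by less than `ε / 2` separates them and changes
  -- differences by less than `ε`.
  obtain ⟨p, hp, hpq⟩ := exists_injective_near q (half_pos hε)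
  obtain ⟨δ, hδ, hsep⟩ := exists_pos_lt_of_finite
    (A := {z : Y × Y // z.1 ≠ z.2}) (fun z => |p z.1.1 - p z.1.2|)
    (fun z => abs_pos.2 (sub_ne_zero.2 (hp.ne z.2)))
  replace hsep : ∀ y z, y ≠ z → δ < |p y - p z| := fun y z h => hsep ⟨(y, z), h⟩
  obtain ⟨B, hB, hlo, hhi⟩ : ∃ B > 0, (∀ v, -B < lo v) ∧ ∀ v, hi v < B := by
    obtain ⟨M₁, h₁⟩ := (Set.finite_range lo).bddBelow
    obtain ⟨M₂, h₂⟩ := (Set.finite_range hi).bddAbove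
    refine ⟨|M₁| + |M₂| + 1, by positivity, fun v => ?_, fun v => ?_⟩
    · linarith [h₁ ⟨v, rfl⟩, neg_abs_le M₁, abs_nonneg M₂]
    · linarith [h₂ ⟨v, rfl⟩, le_abs_self M₂, abs_nonneg M₁]
  obtain ⟨n, ⟨idx⟩⟩ := Finite.exists_equiv_fin E
  -- All heights of `G` lie strictly in `(-B, B)`, so shifts by multiples of `2 * B` give disjoint
  -- slabs.
  let z : E → ℝ := fun e => 2 * B * ((idx e : ℕ) : ℝ)
  have hz0 : ∀ e, 0 ≤ z e := fun e => by positivity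
  have hzn : ∀ e, z e ≤ 2 * B * n := fun e => by
    have : ((idx e : ℕ) : ℝ) ≤ n := by exact_mod_cast (idx e).2.le
    exact mul_le_mul_of_nonneg_left this (by positivity)
  have hzsep : ∀ e e', e ≠ e' → z e + 2 * B ≤ z e' ∨ z e' + 2 * B ≤ z e := by
    intro e e' hne
    have hne' : (idx e : ℕ) ≠ idx e' := fun h => hne (idx.injective (Fin.ext h))
    rcases lt_or_gt_of_ne hne' with h | h
    · left
      have : ((idx e : ℕ) : ℝ) + 1 ≤ (idx e' : ℕ) := by exact_mod_cast h
      change 2 * B * _ + 2 * B ≤ 2 * B * _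
      nlinarith
    · right
      have : ((idx e' : ℕ) : ℝ) + 1 ≤ (idx e : ℕ) := by exact_mod_cast h
      change 2 * B * _ + 2 * B ≤ 2 * B * _
      nlinarith
  have hslab : ∀ e e' u v, lo u + z e ≤ hi v + z e' ∧ lo v + z e' ≤ hi u + z e → e = e' := by
    intro e e' u v h
    by_contra hne
    rcases hzsep e e' hne with h1 | h1
    · linarith [hlo v, hhi u, h.2]
    · linarith [hlo u, hhi v, h.1]
  have hcopy : ∀ e u v, u ≠ v → lo u ≤ hi v ∧ lo v ≤ hi u →
      (|p (inc e u) - p (inc e v)| < min (m e * s u) (m e * s v) ↔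
        |t u - t v| < min (s u) (s v)) ∧
      |p (inc e u) - p (inc e v)| ≠ min (m e * s u) (m e * s v) := by
    intro e u v huv hz
    rw [← mul_min_of_nonneg _ _ (by linarith [hm e])]
    refine abs_lt_iff_of_margin (hm e) (hmargin u v huv hz) ?_
    have h1 := abs_lt.1 (hpq (inc e u))
    have h2 := abs_lt.1 (hpq (inc e v))
    rw [hq] at h1 h2
    rw [abs_lt]
    constructor <;> linarith
  have hms : ∀ e v, 0 < m e * s v := fun e v => mul_pos (by linarith [hm e]) (H.s_pos v)
  -- Pole distances are `0` or exceed `δ`, so a pole of side `δ` meets just the boxes grounded at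
  -- its own point.
  have hpole : ∀ y e v, (|p y - p (inc e v)| < min δ (m e * s v) ↔ inc e v = y) ∧
      |p y - p (inc e v)| ≠ min δ (m e * s v) := by
    intro y e v
    by_cases h : inc e v = y
    · have h0 : 0 < min δ (m e * s v) := lt_min hδ (hms e v)
      simpa [h] using ⟨⟨hδ, hms e v⟩, h0.ne⟩
    · have h1 := (min_le_left δ (m e * s v)).trans_lt (hsep y (inc e v) (Ne.symm h))
      exact ⟨iff_of_false h1.le.not_gt h, h1.ne'⟩
  have hpz : ∀ e v, -B ≤ hi v + z e ∧ lo v + z e ≤ 2 * B * n + B := fun e v =>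
    ⟨by linarith [hlo v, H.lo_lt_hi v, hz0 e], by linarith [hhi v, H.lo_lt_hi v, hzn e]⟩
  refine ⟨Sum.elim p fun x => p (inc x.1 x.2), Sum.elim (fun _ => δ) fun x => m x.1 * s x.2,
    Sum.elim (fun _ => -B) fun x => lo x.2 + z x.1,
    Sum.elim (fun _ => 2 * B * n + B) fun x => hi x.2 + z x.1, ⟨?_, ?_, ?_, ?_, ?_⟩⟩
  · rintro (y | ⟨e, v⟩)
    · exact hδ
    · exact hms e v
  · rintro (y | ⟨e, v⟩)
    · have : 0 ≤ 2 * B * n := by positivity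
      change -B < 2 * B * n + B
      linarith
    · exact add_lt_add_left (H.lo_lt_hi v) _
  · rintro (y | ⟨e, v⟩) (y' | ⟨e', v'⟩) hne
    · refine ⟨False.elim, fun h => ?_⟩
      exact (hsep y y' fun h => hne (congrArg _ h)).not_ge (h.2.le.trans (min_le_left _ _))
    · exact (hpole y e' v').1.symm.trans (and_iff_right (hpz e' v')).symm
    · refine (hpole y' e v).1.symm.trans ?_
      rw [abs_sub_comm, min_comm]
      exact (and_iff_right (hpz e v).symm).symm
    · refine ⟨?_, ?_⟩
      · rintro ⟨h1, h2⟩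
        obtain rfl : e = e' := h1
        obtain ⟨h3, h4⟩ := (H.adj_iff v v' h2.ne).1 h2
        exact ⟨⟨add_le_add_left h3.1 _, add_le_add_left h3.2 _⟩,
          (hcopy e v v' h2.ne h3).1.2 h4⟩
      · rintro ⟨h1, h2⟩
        obtain rfl : e = e' := hslab e e' v v' h1
        have hvv : v ≠ v' := fun h => hne (by rw [h])
        have h3 : lo v ≤ hi v' ∧ lo v' ≤ hi v :=
          ⟨le_of_add_le_add_right h1.1, le_of_add_le_add_right h1.2⟩
        exact ⟨rfl, (H.adj_iff v v' hvv).2 ⟨h3, (hcopy e v v' hvv h3).1.1 h2⟩⟩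
  · rintro (y | ⟨e, v⟩) (y' | ⟨e', v'⟩) hne hz
    · exact ((min_le_left _ _).trans_lt (hsep y y' fun h => hne (congrArg _ h))).ne'
    · exact (hpole y e' v').2
    · have := (hpole y' e v).2
      rwa [abs_sub_comm, min_comm] at this
    · obtain rfl : e = e' := hslab e e' v v' hz
      exact (hcopy e v v' (fun h => hne (by rw [h]))
        ⟨le_of_add_le_add_right hz.1, le_of_add_le_add_right hz.2⟩).2
  · rintro (y | ⟨e, v⟩) (y' | ⟨e', v'⟩) ht hl
    · exact congrArg _ (hp ht)
    · change -B = lo v' + z e' at hl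
      linarith [hlo v', hz0 e']
    · change lo v + z e = -B at hl
      linarith [hlo v, hz0 e]
    · have he : e = e' := hslab e e' v v'
        ⟨by linarith [H.lo_lt_hi v', show lo v + z e = lo v' + z e' from hl],
          by linarith [H.lo_lt_hi v, show lo v + z e = lo v' + z e' from hl]⟩
      subst he
      exact congrArg (fun w => Sum.inr (e, w)) (hinj e (hp ht))

theorem exists_boxRep (g k : ℕ) : ∃ (V : Type) (_ : Finite V) (G : SimpleGraph V)
    (t s lo hi : V → ℝ), IsBoxRep G t s lo hi ∧ IsLocallyAcyclic G g ∧ ¬ G.Colorable k := by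
  induction k with
  | zero =>
    refine ⟨Unit, inferInstance, ⊥, 0, 1, 0, 1, ⟨by simp, by simp, by simp, by simp, by simp⟩,
      ?_, ?_⟩
    · rintro S ⟨v, hv⟩ -
      exact ⟨v, hv, Set.subsingleton_of_subsingleton⟩
    · rintro ⟨c⟩
      exact (c ()).elim0
  | succ k ih =>
    obtain ⟨V, _, G, t, s, lo, hi, H, hG, hk⟩ := ih
    obtain ⟨Y₀, E₀, _, _, inc₀, q, m, b, hinj₀, hun₀, hm, hq⟩ :=
      exists_unavoidable_homothetic V (Fin (k + 1)) t
    obtain ⟨Y, E, _, _, inc, π, ρ, hπ, hun, hsp⟩ :=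
      exists_sparse_lift (Fin (k + 1)) g inc₀ hinj₀ hun₀
    have hinj : ∀ e, Function.Injective (inc e) := fun e u v huv =>
      hinj₀ (ρ e) (by rw [← hπ, ← hπ, huv])
    obtain ⟨t', s', lo', hi', H'⟩ := H.exists_substGraph hinj (fun y => q (π y))
      (fun e => m (ρ e)) (fun e => b (ρ e)) (fun e => hm _) (fun e v => by rw [hπ, hq])
    exact ⟨_, inferInstance, substGraph inc G, t', s', lo', hi', H', hG.substGraph hinj hsp,
      not_colorable_substGraph hun hk⟩

/-! ### From representations to actual boxes. -/

/-- The square box grounded at the point `(t, t)` of the diagonal. -/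
def groundedBox (t s lo hi : ℝ) : Set (Fin 3 → ℝ) :=
  Set.Icc ![t, t - s, lo] ![t + s, t, hi]

theorem isGroundedSquareBox_groundedBox {t s lo hi : ℝ} (hs : 0 < s) (hz : lo < hi) :
    IsGroundedSquareBox (groundedBox t s lo hi) := by
  refine ⟨⟨_, _, ?_, rfl, by simp⟩, ⟨![t, t, lo], ?_, by simp⟩, fun p hp => ?_⟩
  · simp [Fin.forall_fin_succ, hs, hz]
  · simp [groundedBox, Pi.le_def, Fin.forall_fin_succ, hs.le, hz.le]
  · have h0 := hp.1 0
    have h1 := hp.2 1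
    simp at h0 h1
    exact h1.trans h0

/-- For `t ≤ t'`, overlap in `x` means `t' ≤ t + s` and overlap in `y` means `t' - s' ≤ t`, hence
the minimum of the sides. -/
theorem groundedBox_inter_nonempty_iff {t s lo hi t' s' lo' hi' : ℝ} (hs : 0 < s) (hz : lo < hi)
    (hs' : 0 < s') (hz' : lo' < hi') :
    (groundedBox t s lo hi ∩ groundedBox t' s' lo' hi').Nonempty ↔
      (lo ≤ hi' ∧ lo' ≤ hi) ∧ |t - t'| ≤ min s s' := by
  rw [groundedBox, groundedBox, Set.Icc_inter_Icc, Set.nonempty_Icc, Pi.le_def]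
  simp only [Fin.forall_fin_succ, Pi.sup_apply, Pi.inf_apply, sup_le_iff, le_inf_iff, abs_le]
  simp
  constructor
  · rintro ⟨⟨⟨h1, h2⟩, h3, h4⟩, ⟨⟨h5, h6⟩, h7, h8⟩, ⟨h9, h10⟩, h11, h12⟩
    refine ⟨⟨?_, ?_⟩, ?_, ?_⟩ <;> (try constructor) <;> linarith
  · rintro ⟨⟨h1, h2⟩, ⟨h3, h4⟩, h5, h6⟩
    refine ⟨⟨⟨?_, ?_⟩, ?_, ?_⟩, ⟨⟨?_, ?_⟩, ?_, ?_⟩, ⟨?_, ?_⟩, ?_, ?_⟩ <;> linarith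

theorem eq_and_eq_of_groundedBox_eq {t s lo hi t' s' lo' hi' : ℝ} (hs : 0 < s) (hz : lo < hi)
    (h : groundedBox t s lo hi = groundedBox t' s' lo' hi') : t = t' ∧ lo = lo' := by
  have hle : ![t, t - s, lo] ≤ ![t + s, t, hi] := by
    simp [Pi.le_def, Fin.forall_fin_succ, hs.le, hz.le]
  have h1 := ((Set.Icc_eq_Icc_iff hle).1 h).1
  exact ⟨congrFun h1 0, congrFun h1 2⟩

theorem IsBoxRep.exists_iso {V : Type} {G : SimpleGraph V} {t s lo hi : V → ℝ}
    (H : IsBoxRep G t s lo hi) : Nonempty (G ≃g intersectionGraph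
      (Set.range fun v => groundedBox (t v) (s v) (lo v) (hi v))) := by
  have hinj : Function.Injective fun v => groundedBox (t v) (s v) (lo v) (hi v) := by
    intro u v huv
    obtain ⟨h1, h2⟩ := eq_and_eq_of_groundedBox_eq (H.s_pos u) (H.lo_lt_hi u) huv
    exact H.ext u v h1 h2
  refine ⟨⟨Equiv.ofInjective _ hinj, fun {u v} => ?_⟩⟩
  by_cases huv : u = v
  · subst huv
    simp
  · rw [H.adj_iff u v huv]
    change _ ≠ _ ∧ (groundedBox _ _ _ _ ∩ groundedBox _ _ _ _).Nonempty ↔ _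
    rw [groundedBox_inter_nonempty_iff (H.s_pos u) (H.lo_lt_hi u) (H.s_pos v) (H.lo_lt_hi v),
      and_iff_right ((Equiv.ofInjective _ hinj).injective.ne huv)]
    exact and_congr_right fun hz =>
      ⟨fun h => lt_of_le_of_ne h (H.generic u v huv hz), le_of_lt⟩

theorem le_egirth_of_iso {V W : Type} {G : SimpleGraph V} {G' : SimpleGraph W} {g : ℕ}
    (H : (g : ℕ∞) ≤ G.egirth) (f : G ≃g G') : (g : ℕ∞) ≤ G'.egirth := by
  rw [SimpleGraph.le_egirth] at H ⊢
  intro a w hw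
  have := H _ _ (hw.map (f := f.symm.toHom) f.symm.injective)
  rwa [SimpleGraph.Walk.length_map] at this

theorem exists_groundedSquareBoxes (g k : ℕ) :
    ∃ 𝓑 : Set (Set (Fin 3 → ℝ)), 𝓑.Finite ∧ (∀ B ∈ 𝓑, IsGroundedSquareBox B) ∧
      (g : ℕ∞) ≤ (intersectionGraph 𝓑).egirth ∧
      (k : ℕ∞) ≤ (intersectionGraph 𝓑).chromaticNumber := by
  obtain ⟨V, _, G, t, s, lo, hi, H, hg, hk⟩ := exists_boxRep g k
  obtain ⟨f⟩ := H.exists_iso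
  refine ⟨_, Set.finite_range _, ?_, le_egirth_of_iso hg.le_egirth f, ?_⟩
  · rintro _ ⟨v, rfl⟩
    exact isGroundedSquareBox_groundedBox (H.s_pos v) (H.lo_lt_hi v)
  · rw [SimpleGraph.le_chromaticNumber_iff_colorable]
    intro m hm
    by_contra hlt
    exact hk ((hm.of_hom f.toHom).mono (not_le.1 hlt).le)

theorem mainTheorem1 :
    (∀ g k : ℕ, 3 ≤ g → 1 ≤ k →
      ∃ 𝓑 : Set (Set (Fin 3 → ℝ)), 𝓑.Finite ∧ (∀ B ∈ 𝓑, IsGroundedSquareBox B) ∧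
        (g : ℕ∞) ≤ (intersectionGraph 𝓑).egirth ∧
        (k : ℕ∞) ≤ (intersectionGraph 𝓑).chromaticNumber) ∧
    (∀ g k : ℕ,
      ∃ 𝓑 : Set (Set (Fin 3 → ℝ)), 𝓑.Finite ∧ (∀ B ∈ 𝓑, IsAxisBox B) ∧
        (g : ℕ∞) ≤ (intersectionGraph 𝓑).egirth ∧
        (k : ℕ∞) ≤ (intersectionGraph 𝓑).chromaticNumber) := by
  refine ⟨fun g k _ _ => exists_groundedSquareBoxes g k, fun g k => ?_⟩
  obtain ⟨𝓑, hfin, hbox, hgk⟩ := exists_groundedSquareBoxes g k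
  refine ⟨𝓑, hfin, fun B hB => ?_, hgk⟩
  obtain ⟨⟨a, b, hab, rfl, -⟩, -⟩ := hbox B hB
  exact ⟨a, b, hab, rfl⟩
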